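/- For a field $E$ let $G_E=\mathrm{Gal}(\overline E/E)$ denote its absolute Galois group (a profinite group), and consider finite groups as discrete topological groups. Let $k$ be an algebraically closed field. (a) Let $l$ be a prime number with $\mathrm{char}\,k\ne l$, and let $G$ be a finite group. All cohomology groups are continuous cohomology groups with coefficients in the discrete group $\mathbb{Q}_l/\mathbb{Z}_l$ with the trivial action. 1. There exist a field $E$ over $k$ and a continuous homomorphism $G_E\to G$ such that the induced map $H^2(G,\mathbb{Q}_l/\mathbb{Z}_l)\to H^2(G_E,\mathbb{Q}_l/\mathbb{Z}_l)$ is injective. 2. One can take $E=k(V)^G$ for any faithful linear representation $V$ of $G$ in a finite-dimensional $k$-vector space, where $k(V)$ is the field of rational functions on $V$: for every embedding of $k(V)$ over $E$ into $\overline E$ (such embeddings exist), the corresponding natural homomorphism $G_E\to\mathrm{Gal}(k(V)/k(V)^G)=G$ is a continuous surjection, and the map that it induces on $H^2(-,\mathbb{Q}_l/\mathbb{Z}_l)$ is injective. 3. Let $n\ge 0$ and let $0\to\mathbb{Z}/l^n\to G'\to G\to 1$ be a central extension that is not induced from an extension of cyclic groups, that is, for no $m\ge 0$ and no homomorphism $\chi\colon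 G\to\mathbb{Z}/l^m$ is it equivalent to the pullback along $\chi$ of the extension $0\to\mathbb{Z}/l^n\xrightarrow{\,l^m\,}\mathbb{Z}/l^{n+m}\to\mathbb{Z}/l^m\to 0$. Then there exist a field $E$ over $k$ and a continuous homomorphism $G_E\to G$ that cannot be lifted to a continuous homomorphism $G_E\to G'$. (b) Let $D_n$ denote the dihedral group of order $2n$, and let $D_{2n}\to D_n$ be the natural surjection (reduction modulo $n$ of the indices of rotations and reflections). If $\mathrm{char}\,k\ne 2$, then for every even $n\ge 2$ there exist a field $K$ over $k$ and a continuous homomorphism $G_K\to D_n$ that cannot be lifted to a continuous homomorphism $G_K\to D_{2n}$. -/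

import Mathlib

universe u v w

section Coefficients

variable (l : ℕ) [Fact l.Prime]

/-- The discrete divisible `l`-primary torsion group `ℚ_l / ℤ_l` (the quotient topology is
discrete, because `ℤ_l` is open in `ℚ_l`; see the instance below). -/
abbrev QlModZl : Type := ℚ_[l] ⧸ (PadicInt.subring l).toAddSubgroup

instance QlModZl.instDiscreteTopology : DiscreteTopology (QlModZl l) := by
  have h : IsOpen ((PadicInt.subring l).toAddSubgroup : Set ℚ_[l]) := by
    have : ((PadicInt.subring l).toAddSubgroup : Set ℚ_[l]) = Metric.closedBall 0 1 := by
      ext x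
      simp [PadicInt.subring]
    rw [this]
    exact IsUltrametricDist.isOpen_closedBall 0 one_ne_zero
  exact QuotientAddGroup.discreteTopology h

/-- `ℚ_l / ℤ_l` (placed in the universe of `Γ`) with the trivial action of a group `Γ`. -/
noncomputable abbrev trivialQlModZl (Γ : Type u) [Group Γ] : TopRep.{u} ℤ Γ :=
  TopRep.of (ContRepresentation.trivial ℤ Γ (ULift.{u} (QlModZl l)))

/-- The map `H²(Γ, ℚ_l/ℤ_l) → H²(Δ, ℚ_l/ℤ_l)` of continuous cohomology groups (with the trivial
action on the coefficients) that is induced by a continuous homomorphism `φ : Δ → Γ`. -/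
noncomputable abbrev inflationH2 {Γ Δ : Type u}
    [Group Γ] [TopologicalSpace Γ] [IsTopologicalGroup Γ]
    [Group Δ] [TopologicalSpace Δ] [IsTopologicalGroup Δ] (φ : Δ →ₜ* Γ) :
    continuousCohomology 2 (trivialQlModZl l Γ) ⟶ continuousCohomology 2 (trivialQlModZl l Δ) :=
  ContinuousCohomology.map φ
    (CategoryTheory.CategoryStruct.id (TopRep.res (φ : Δ →* Γ) (trivialQlModZl l Γ))) 2

end Coefficients

section RationalFunctions

variable {k : Type u} [Field k] {G : Type v} [Group G] {V : Type w} [AddCommGroup V] [Module k V]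

/-- The ring `k[V]` of polynomial functions on a finite-dimensional vector space `V`. -/
abbrev PolyFun (k : Type u) [Field k] (V : Type w) [AddCommGroup V] [Module k V] : Type (max u w) :=
  SymmetricAlgebra k (Module.Dual k V)

/-- The field `k(V)` of rational functions on a finite-dimensional vector space `V`. -/
abbrev RatFun (k : Type u) [Field k] (V : Type w) [AddCommGroup V] [Module k V] : Type (max u w) :=
  FractionRing (PolyFun k V)

/-- The action of `G` on `k[V]` by algebra endomorphisms, `(g f)(v) = f(g⁻¹ v)`. -/
noncomputable def polyFunEnd (ρ : Representation k G V) : G →* (PolyFun k V →ₐ[k] PolyFun k V) where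
  toFun g := SymmetricAlgebra.lift (SymmetricAlgebra.ι k (Module.Dual k V) ∘ₗ ρ.dual g)
  map_one' := by
    ext x
    simp only [map_one]
    simp
  map_mul' g h := by
    ext x
    simp only [map_mul]
    simp

/-- The action of `G` on `k[V]` by algebra automorphisms. -/
noncomputable def polyFunAction (ρ : Representation k G V) :
    G →* (PolyFun k V ≃ₐ[k] PolyFun k V) :=
  (AlgEquiv.algHomUnitsEquiv k (PolyFun k V)).toMonoidHom.comp (polyFunEnd ρ).toHomUnits

/-- The action of `G` on `k(V)` by field automorphisms over `k`. -/
noncomputable def ratFunAction (ρ : Representation k G V) :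
    G →* (RatFun k V ≃ₐ[k] RatFun k V) :=
  (IsFractionRing.fieldEquivOfAlgEquivHom k (RatFun k V)).comp (polyFunAction ρ)

/-- The field `k(V)^G` of `G`-invariant rational functions on `V`. -/
noncomputable abbrev invariantField (ρ : Representation k G V) : IntermediateField k (RatFun k V) :=
  IntermediateField.fixedField (ratFunAction ρ).range

/-- Let `E = k(V)^G` and let `ι` be an embedding of `k(V)` over `E` into the algebraic closure
of `E`.  This says that `φ` is the natural homomorphism `G_E → Gal(k(V)/k(V)^G) = G`, the
restriction of automorphisms of the algebraic closure to its subfield `ι(k(V))`. -/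
def IsNaturalHom (ρ : Representation k G V)
    (ι : RatFun k V →ₐ[invariantField ρ] AlgebraicClosure (invariantField ρ))
    [TopologicalSpace G] (φ : Field.absoluteGaloisGroup (invariantField ρ) →ₜ* G) : Prop :=
  ∀ (σ : AlgebraicClosure (invariantField ρ) ≃ₐ[invariantField ρ]
      AlgebraicClosure (invariantField ρ)) (x : RatFun k V),
    σ (ι x) = ι (ratFunAction ρ (φ σ) x)

end RationalFunctions

section Extensions

/-- The pullback of a group extension `1 → N → X → H → 1` along a homomorphism `χ : G → H`:
the middle group is the fibre product `X ×_H G`. -/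
def GroupExtension.pullback {N X H G : Type*} [Group N] [Group X] [Group H] [Group G]
    (S : GroupExtension N X H) (χ : G →* H) :
    GroupExtension N
      (MonoidHom.eqLocus (S.rightHom.comp (MonoidHom.fst X G)) (χ.comp (MonoidHom.snd X G))) G where
  inl := ((MonoidHom.inl X G).comp S.inl).codRestrict _ fun x => by
    change S.rightHom (S.inl x) = χ 1
    simp
  rightHom := (MonoidHom.snd X G).comp (Subgroup.subtype _)
  inl_injective := by
    intro a b h
    exact S.inl_injective (congrArg (fun z => z.1.1) h)
  range_inl_eq_ker_rightHom := by
    ext ⟨⟨x, g⟩, hx⟩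
    have hx' : S.rightHom x = χ g := hx
    constructor
    · rintro ⟨a, ha⟩
      exact (congrArg (fun z => z.1.2) ha).symm
    · intro h
      have hg : g = 1 := h
      subst hg
      have hk : x ∈ S.rightHom.ker := by simpa [MonoidHom.mem_ker] using hx'
      rw [← S.range_inl_eq_ker_rightHom] at hk
      obtain ⟨a, ha⟩ := hk
      exact ⟨a, Subtype.ext (Prod.ext ha rfl)⟩
  rightHom_surjective := by
    intro g
    obtain ⟨x, hx⟩ := S.rightHom_surjective (χ g)
    exact ⟨⟨(x, g), hx⟩, rfl⟩

variable (l n m : ℕ)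

/-- The embedding `ℤ/lⁿ → ℤ/lⁿ⁺ᵐ`, the multiplication by `lᵐ`. -/
def cyclicInl : ZMod (l ^ n) →+ ZMod (l ^ (n + m)) :=
  ZMod.lift (l ^ n) ⟨zmultiplesHom _ ((l ^ m : ℕ) : ZMod (l ^ (n + m))), by
    rw [zmultiplesHom_apply, natCast_zsmul, nsmul_eq_mul, ← Nat.cast_mul, ← pow_add,
      ZMod.natCast_self]⟩

theorem cyclicInl_intCast (a : ℤ) :
    cyclicInl l n m (a : ZMod (l ^ n)) = ((a * l ^ m : ℤ) : ZMod (l ^ (n + m))) := by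
  simp [cyclicInl]

/-- The reduction `ℤ/lⁿ⁺ᵐ → ℤ/lᵐ`. -/
def cyclicProj : ZMod (l ^ (n + m)) →+ ZMod (l ^ m) :=
  (ZMod.castHom (pow_dvd_pow l (Nat.le_add_left m n)) (ZMod (l ^ m))).toAddMonoidHom

theorem cyclicProj_intCast (a : ℤ) :
    cyclicProj l n m (a : ZMod (l ^ (n + m))) = (a : ZMod (l ^ m)) := by
  simp [cyclicProj]

/-- The extension of cyclic groups `0 → ℤ/lⁿ → ℤ/lⁿ⁺ᵐ → ℤ/lᵐ → 0`. -/
def cyclicExtension [Fact l.Prime] :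
    GroupExtension (Multiplicative (ZMod (l ^ n))) (Multiplicative (ZMod (l ^ (n + m))))
      (Multiplicative (ZMod (l ^ m))) where
  inl := AddMonoidHom.toMultiplicative (cyclicInl l n m)
  rightHom := AddMonoidHom.toMultiplicative (cyclicProj l n m)
  inl_injective := by
    have hl : (l : ℤ) ≠ 0 := by exact_mod_cast (Fact.out : l.Prime).ne_zero
    have h : Function.Injective (cyclicInl l n m) := by
      rw [injective_iff_map_eq_zero]
      intro a ha
      obtain ⟨a, rfl⟩ := ZMod.intCast_surjective a
      rw [cyclicInl_intCast, ZMod.intCast_zmod_eq_zero_iff_dvd] at ha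
      rw [ZMod.intCast_zmod_eq_zero_iff_dvd]
      push_cast [pow_add] at ha ⊢
      exact (mul_dvd_mul_iff_right (pow_ne_zero m hl)).1 ha
    exact h
  range_inl_eq_ker_rightHom := by
    have h : ∀ b, (∃ a, cyclicInl l n m a = b) ↔ cyclicProj l n m b = 0 := by
      intro b
      obtain ⟨b, rfl⟩ := ZMod.intCast_surjective b
      rw [cyclicProj_intCast, ZMod.intCast_zmod_eq_zero_iff_dvd]
      constructor
      · rintro ⟨a, ha⟩
        obtain ⟨a, rfl⟩ := ZMod.intCast_surjective a
        rw [cyclicInl_intCast, ZMod.intCast_eq_intCast_iff_dvd_sub] at ha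
        have h1 : ((l ^ m : ℕ) : ℤ) ∣ b - a * l ^ m :=
          dvd_trans (by push_cast; exact pow_dvd_pow _ (Nat.le_add_left m n)) ha
        have h2 : ((l ^ m : ℕ) : ℤ) ∣ a * l ^ m := by push_cast; exact dvd_mul_left _ _
        simpa using dvd_add h1 h2
      · rintro ⟨a, rfl⟩
        refine ⟨(a : ZMod (l ^ n)), ?_⟩
        rw [cyclicInl_intCast]
        push_cast
        ring
    ext b
    exact h b.toAdd
  rightHom_surjective := by
    have h : Function.Surjective (cyclicProj l n m) := by
      intro a
      obtain ⟨a, rfl⟩ := ZMod.intCast_surjective a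
      exact ⟨a, cyclicProj_intCast l n m a⟩
    exact h

/-- A group extension of `G` by `ℤ/lⁿ` is induced from an extension of cyclic groups if for some
`m ≥ 0` it is equivalent to the pullback of `0 → ℤ/lⁿ → ℤ/lⁿ⁺ᵐ → ℤ/lᵐ → 0` along some homomorphism
`G → ℤ/lᵐ`. -/
def IsInducedFromCyclic {l : ℕ} [Fact l.Prime] {n : ℕ} {X G : Type*} [Group X] [Group G]
    (S : GroupExtension (Multiplicative (ZMod (l ^ n))) X G) : Prop :=
  ∃ (m : ℕ) (χ : G →* Multiplicative (ZMod (l ^ m))),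
    Nonempty (S.Equiv ((cyclicExtension l n m).pullback χ))

end Extensions

section Dihedral

/-- The natural surjection `D_{2n} → D_n` of dihedral groups, where `D_n` has order `2n`; it sends
rotations to rotations and reflections to reflections, and reduces their indices modulo `n`. -/
def dihedralProj (n : ℕ) : DihedralGroup (2 * n) →* DihedralGroup n where
  toFun
    | .r i => .r (ZMod.castHom (Dvd.intro_left 2 rfl) (ZMod n) i)
    | .sr i => .sr (ZMod.castHom (Dvd.intro_left 2 rfl) (ZMod n) i)
  map_one' := by
    change DihedralGroup.r _ = DihedralGroup.r 0
    simp
  map_mul' := by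
    rintro (i | i) (j | j) <;> simp

/-- Finite groups are considered as discrete topological groups. -/
instance DihedralGroup.instTopologicalSpace (n : ℕ) : TopologicalSpace (DihedralGroup n) := ⊥

instance DihedralGroup.instDiscreteTopology (n : ℕ) : DiscreteTopology (DihedralGroup n) := ⟨rfl⟩

end Dihedral

/-! Put `F = k(V)` and `E = F^G`, so that `Gal(F/E) = G` for a faithful `V`. Injectivity on `H²` is
proved by enlarging the coefficients. Since `ℚ_l/ℤ_l` and `kˣ` are divisible and `k` contains the
`l`-th roots of unity, `ℚ_l/ℤ_l` is a direct summand of `kˣ` (`QlModZl.exists_retract_units`), so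
`kˣ` may replace it. A class of `H²(G, kˣ)` that dies on `G_E` dies already in `H²(G, Fˣ)`, by
Hilbert 90 for `F` (`exists_coboundary_of_inflation`). Finally `H²(G, kˣ) → H²(G, Fˣ)` is injective
(`exists_const_coboundary_of_coboundary`): `k[V]` is factorial with units `kˣ`, so `Fˣ/kˣ` is the
permutation module of divisors, whose `H¹` vanishes. The algebraic closure may be inseparable, so
the descent holds only up to a power of the characteristic exponent; this is harmless because
Frobenius is bijective on `k`.

If `G_E → G` lifts to a central extension with kernel `N`, then for every `N → ℚ_l/ℤ_l` the
pushed-out class dies on `G_E`, hence is zero, and the homomorphism extends to the middle group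
(`exists_extension_of_lift`). For the embedding of `N = ℤ/lⁿ` this makes the extension induced from
cyclic groups; for `D_{2n} → D_n` with `n` even it is impossible, because the kernel consists of
commutators. -/

/-! ### Constants and rational functions: the divisor argument -/

/-- In a unique factorization domain with a finite group acting by automorphisms, a `1`-cocycle
modulo units `g ↦ n g / d` with values in the fraction field is a coboundary modulo units: the
greatest common divisor of the numerators provides the cochain. -/
theorem exists_associated_mul_of_cocycle {R G : Type*} [CommRing R] [IsDomain R]
    [UniqueFactorizationMonoid R] [Group G] [Finite G] (α : G → R ≃+* R) (n : G → R) (d : R)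
    (hn : ∀ g, n g ≠ 0)
    (h : ∀ g h, Associated (n (g * h) * α g d) (n g * α g (n h))) :
    ∃ N : R, N ≠ 0 ∧ ∀ g, Associated (N * α g d) (n g * α g N) := by
  classical
  cases nonempty_fintype G
  let _ : StrongNormalizationMonoid R := UniqueFactorizationMonoid.strongNormalizationMonoid
  let _ : StrongNormalizedGCDMonoid R :=
    UniqueFactorizationMonoid.toStrongNormalizedGCDMonoid R
  refine ⟨Finset.univ.gcd n, fun h0 ↦ hn 1 (Finset.gcd_eq_zero_iff.1 h0 1 (Finset.mem_univ _)),
    fun g ↦ ?_⟩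
  have key : ∀ (f : G → R) (c : R), Associated (Finset.univ.gcd f * c)
      (Finset.univ.gcd fun x ↦ f x * c) := fun f c ↦ by
    rw [Finset.gcd_mul_right]
    exact (Associated.refl _).mul_left _ |>.trans (associated_normalize c |>.mul_left _)
  have key' : ∀ (f : G → R) (c : R), Associated (c * Finset.univ.gcd f)
      (Finset.univ.gcd fun x ↦ c * f x) := fun f c ↦ by
    simpa only [mul_comm c] using key f c
  have hα : Associated (α g (Finset.univ.gcd n)) (Finset.univ.gcd fun x ↦ α g (n x)) := by
    refine associated_of_dvd_dvd (Finset.dvd_gcd fun x hx ↦ map_dvd (α g) (Finset.gcd_dvd hx)) ?_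
    rw [← (α g).apply_symm_apply (Finset.univ.gcd fun x ↦ α g (n x))]
    refine map_dvd (α g) (Finset.dvd_gcd fun x hx ↦ ?_)
    have := map_dvd (α g).symm (Finset.gcd_dvd (f := fun x ↦ α g (n x)) hx)
    simpa using this
  refine (key n (α g d)).trans (.trans ?_ ((key' _ (n g)).symm.trans (hα.symm.mul_left _)))
  -- Taking the gcd over `x` of the cocycle relation for `(g, x)` gives the claim, since `x ↦ g * x`
  -- permutes the index set.
  refine associated_of_dvd_dvd (Finset.dvd_gcd fun x _ ↦ ?_) (Finset.dvd_gcd fun x _ ↦ ?_)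
  · exact (Finset.gcd_dvd (f := fun x ↦ n x * α g d) (Finset.mem_univ (g * x))).trans (h g x).dvd
  · have := (Finset.gcd_dvd (f := fun x ↦ n g * α g (n x)) (Finset.mem_univ (g⁻¹ * x))).trans
      (h g (g⁻¹ * x)).symm.dvd
    simpa using this

/-- If a finite group acts on a unique factorization domain `R` whose units are the nonzero
constants from a field `k`, and on its fraction field `F`, then `H²(G, kˣ) → H²(G, Fˣ)` is
injective. -/
theorem exists_const_coboundary_of_coboundary {k R F G : Type*} [Field k] [CommRing R] [IsDomain R]
    [UniqueFactorizationMonoid R] [Algebra k R] [Field F] [Algebra R F] [IsFractionRing R F]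
    [Algebra k F] [IsScalarTower k R F] [Group G] [Finite G]
    (hu : ∀ r : R, IsUnit r → ∃ x : kˣ, algebraMap k R x = r)
    (α : G → R ≃+* R) (β : G →* (F ≃ₐ[k] F))
    (hαβ : ∀ g r, β g (algebraMap R F r) = algebraMap R F (α g r))
    (c : G → G → kˣ) (a : G → F) (ha : ∀ g, a g ≠ 0)
    (h : ∀ g h, algebraMap k F (c g h) * a (g * h) = a g * β g (a h)) :
    ∃ u : G → kˣ, ∀ g h, c g h * u (g * h) = u g * u h := by
  classical
  cases nonempty_fintype G
  have hinj : Function.Injective (algebraMap R F) := IsFractionRing.injective R F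
  obtain ⟨d, hd⟩ := IsLocalization.exist_integer_multiples (nonZeroDivisors R) Finset.univ a
  have hd0 : (d : R) ≠ 0 := nonZeroDivisors.coe_ne_zero d
  have hd1 : algebraMap R F d ≠ 0 := (map_ne_zero_iff _ hinj).2 hd0
  choose n hn using fun g ↦ hd g (Finset.mem_univ g)
  have hn' : ∀ g, algebraMap R F (n g) = algebraMap R F d * a g := fun g ↦ by
    rw [hn g, Algebra.smul_def]
  have hn0 : ∀ g, n g ≠ 0 := fun g h0 ↦ by
    have := hn' g
    rw [h0, map_zero] at this
    exact mul_ne_zero hd1 (ha g) this.symm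
  -- Modulo units the constants `c` disappear, so `a = n / d` becomes a `1`-cocycle.
  obtain ⟨N, hN0, hN⟩ := exists_associated_mul_of_cocycle α n d hn0 fun g h' ↦ by
    refine ⟨Units.map (algebraMap k R).toMonoidHom (c g h'), hinj ?_⟩
    simp only [map_mul, hn', ← hαβ, Units.coe_map, RingHom.toMonoidHom_eq_coe, MonoidHom.coe_coe,
      ← IsScalarTower.algebraMap_apply k R F]
    linear_combination (algebraMap R F d * β g (algebraMap R F d)) * h g h'
  have hN1 : algebraMap R F N ≠ 0 := (map_ne_zero_iff _ hinj).2 hN0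
  have : ∀ g, ∃ x : kˣ, n g * α g N = N * α g d * algebraMap k R x := fun g ↦ by
    obtain ⟨e, he⟩ := hN g
    obtain ⟨x, hx⟩ := hu e e.isUnit
    exact ⟨x, by rw [hx, he]⟩
  choose u hu' using this
  have hu1 : ∀ g, a g * algebraMap R F d * β g (algebraMap R F N) =
      algebraMap R F N * β g (algebraMap R F d) * algebraMap k F (u g) := fun g ↦ by
    have := congrArg (algebraMap R F) (hu' g)
    simp only [map_mul, hn', ← hαβ, ← IsScalarTower.algebraMap_apply k R F] at this
    linear_combination this
  obtain ⟨f, hf0, hf⟩ : ∃ f : F, f ≠ 0 ∧ ∀ g, a g = f / β g f * algebraMap k F (u g) := by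
    refine ⟨algebraMap R F N / algebraMap R F d, div_ne_zero hN1 hd1, fun g ↦ ?_⟩
    have h1 : β g (algebraMap R F N) ≠ 0 := by simp [hN0]
    have h2 : β g (algebraMap R F d) ≠ 0 := by simp
    rw [map_div₀]
    field_simp
    linear_combination hu1 g
  have hβ0 : ∀ g, β g f ≠ 0 := fun g ↦ by simpa using hf0
  -- The factor `f / β g f` is a `1`-cocycle and cancels, and `β g` fixes the constant `u h'`; so
  -- `u` cobounds `c` just as `a` does.
  refine ⟨u, fun g h' ↦ Units.ext ((algebraMap k F).injective ?_)⟩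
  have := h g h'
  rw [hf, hf, hf, map_mul (β g), map_div₀, ← AlgEquiv.mul_apply, ← map_mul, AlgEquiv.commutes]
    at this
  have h1 := hβ0 g
  have h2 := hβ0 (g * h')
  field_simp at this
  simpa [mul_comm, mul_left_comm] using this

/-! ### Normal extensions: fixed elements and Hilbert 90 -/

/-- An element of a normal extension that is fixed by all automorphisms is purely inseparable. -/
theorem exists_pow_mem_of_forall_fixed (F Ω : Type*) [Field F] [Field Ω] [Algebra F Ω]
    [Normal F Ω] (q : ℕ) [ExpChar F q] (x : Ω) (hx : ∀ σ : Ω ≃ₐ[F] Ω, σ x = x) :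
    ∃ m : ℕ, x ^ q ^ m ∈ (algebraMap F Ω).range := by
  classical
  rw [← mem_perfectClosure_iff_pow_mem, mem_perfectClosure_iff_natSepDegree_eq_one]
  rw [Polynomial.natSepDegree_eq_of_splits _ (E := Ω) (Normal.splits inferInstance x),
    Finset.card_eq_one]
  have hint : IsIntegral F x := Normal.isIntegral inferInstance x
  refine ⟨x, Finset.eq_singleton_iff_unique_mem.2 ⟨?_, fun y hy ↦ ?_⟩⟩
  · simpa [Polynomial.mem_aroots] using minpoly.ne_zero hint
  · rw [Multiset.mem_toFinset, Polynomial.mem_aroots] at hy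
    obtain ⟨σ, hσ⟩ := minpoly.exists_algEquiv_of_root' hint.isAlgebraic hy.2
    rw [← hσ, hx σ]

/-- Hilbert 90 for characters of an infinite Galois group. -/
theorem exists_eigenvector_of_character (F Ω : Type*) [Field F] [Field Ω] [Algebra F Ω]
    [Normal F Ω] (χ : (Ω ≃ₐ[F] Ω) →* Fˣ) (hχ : IsOpen (χ.ker : Set (Ω ≃ₐ[F] Ω))) :
    ∃ y : Ω, y ≠ 0 ∧ ∀ σ, σ y = algebraMap F Ω (χ σ) * y := by
  -- An open kernel contains the fixing subgroup of a finite normal `L`, so `χ` factors through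
  -- `Gal(L/F)`; its values lie in `F`, hence it is a `1`-cocycle there.
  obtain ⟨L, _, _, hL⟩ := (krullTopology_mem_nhds_one_iff_of_normal F Ω _).1
    (hχ.mem_nhds (one_mem χ.ker))
  have hsurj : Function.Surjective (AlgEquiv.restrictNormalHom (F := F) (K₁ := Ω) L) :=
    AlgEquiv.restrictNormalHom_surjective Ω
  have hker : (AlgEquiv.restrictNormalHom (F := F) (K₁ := Ω) L).ker ≤ χ.ker := by
    rw [IntermediateField.restrictNormalHom_ker]
    exact hL
  let χ' : (L ≃ₐ[F] L) →* Fˣ := MonoidHom.liftOfSurjective _ hsurj ⟨χ, hker⟩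
  have hχ' : ∀ σ, χ' (AlgEquiv.restrictNormalHom L σ) = χ σ :=
    MonoidHom.liftOfRightInverse_comp_apply _ _ (Function.rightInverse_surjInv hsurj) ⟨χ, hker⟩
  obtain ⟨y, hy⟩ := groupCohomology.isMulCoboundary₁_of_isMulCocycle₁_of_aut_to_units
    (fun σ : L ≃ₐ[F] L ↦ Units.map (algebraMap F L).toMonoidHom (χ' σ)) fun σ τ ↦ by
      refine Units.ext ?_
      beta_reduce
      rw [map_mul, map_mul, mul_comm]
      refine congrArg (fun z : Lˣ ↦ ((z * _ : Lˣ) : L)) (Units.ext ?_)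
      exact (σ.commutes _).symm
  refine ⟨(y : L), by simp, fun σ ↦ ?_⟩
  have := hy (AlgEquiv.restrictNormalHom L σ)
  beta_reduce at this
  rw [div_eq_iff_eq_mul, hχ'] at this
  have := congrArg (fun z : Lˣ ↦ algebraMap L Ω z) this
  simpa [AlgEquiv.smul_units_def, AlgEquiv.restrictNormalHom_apply] using this

/-! ### The group `ℚ_l/ℤ_l` and its embedding into `kˣ` -/

theorem QlModZl.mk_eq_zero_iff {l : ℕ} [Fact l.Prime] (x : ℚ_[l]) :
    (QuotientAddGroup.mk x : QlModZl l) = 0 ↔ ‖x‖ ≤ 1 := by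
  rw [QuotientAddGroup.eq_zero_iff]
  simp [PadicInt.subring]

theorem QlModZl.exists_pow_smul_eq_zero {l : ℕ} [Fact l.Prime] (x : QlModZl l) :
    ∃ m : ℕ, (l ^ m) • x = 0 := by
  obtain ⟨x, rfl⟩ := QuotientAddGroup.mk_surjective x
  obtain ⟨m, hm⟩ := pow_unbounded_of_one_lt ‖x‖
    (show (1 : ℝ) < l by exact_mod_cast (Fact.out : l.Prime).one_lt)
  refine ⟨m, ?_⟩
  rw [← QuotientAddGroup.mk_nsmul, QlModZl.mk_eq_zero_iff, nsmul_eq_mul]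
  have h0 : (0 : ℝ) < l := by exact_mod_cast (Fact.out : l.Prime).pos
  rw [norm_mul, Nat.cast_pow, norm_pow, Padic.norm_p, inv_pow, inv_mul_le_iff₀ (by positivity),
    mul_one]
  exact hm.le

/-- The elements of `ℚ_l / ℤ_l` that are killed by `lᵐ` are the multiples of the class of `l⁻ᵐ`. -/
theorem QlModZl.exists_eq_nsmul_of_pow_smul_eq_zero {l : ℕ} [Fact l.Prime] {m : ℕ} {x : QlModZl l}
    (hx : (l ^ m) • x = 0) : ∃ a : ℕ, x = a • QuotientAddGroup.mk ((l : ℚ_[l]) ^ m)⁻¹ := by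
  obtain ⟨x, rfl⟩ := QuotientAddGroup.mk_surjective x
  rw [← QuotientAddGroup.mk_nsmul, QlModZl.mk_eq_zero_iff, nsmul_eq_mul, Nat.cast_pow] at hx
  have hl : (l : ℚ_[l]) ^ m ≠ 0 :=
    pow_ne_zero _ (by exact_mod_cast (Fact.out : l.Prime).ne_zero)
  let w : ℤ_[l] := ⟨_, hx⟩
  -- The multiple is a natural number congruent to the `l`-adic integer `lᵐ x` modulo `lᵐ`.
  refine ⟨w.appr m, ?_⟩
  obtain ⟨t, ht⟩ := Ideal.mem_span_singleton.1 (PadicInt.appr_spec m w)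
  rw [← QuotientAddGroup.mk_nsmul, ← sub_eq_zero, ← QuotientAddGroup.mk_sub,
    QlModZl.mk_eq_zero_iff, nsmul_eq_mul]
  have ht' := congrArg (fun z : ℤ_[l] ↦ (z : ℚ_[l])) ht
  have hw : (w : ℚ_[l]) = l ^ m * x := rfl
  simp only [PadicInt.coe_sub, PadicInt.coe_mul, PadicInt.coe_pow, PadicInt.coe_natCast, hw] at ht'
  have : x - (w.appr m : ℚ_[l]) * ((l : ℚ_[l]) ^ m)⁻¹ = t := by
    field_simp
    linear_combination ht'
  rw [this]
  exact t.2

/-- The class of `l⁻ᵐ` in `ℚ_l / ℤ_l` has order `lᵐ`. -/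
theorem QlModZl.zsmul_eq_zero_iff {l : ℕ} [Fact l.Prime] (m : ℕ) (a : ℤ) :
    a • (QuotientAddGroup.mk ((l : ℚ_[l]) ^ m)⁻¹ : QlModZl l) = 0 ↔ ((l ^ m : ℕ) : ℤ) ∣ a := by
  have h0 : (0 : ℝ) < l := by exact_mod_cast (Fact.out : l.Prime).pos
  rw [← QuotientAddGroup.mk_zsmul, QlModZl.mk_eq_zero_iff, zsmul_eq_mul, norm_mul, norm_inv,
    norm_pow, Padic.norm_p, mul_inv_le_iff₀ (by positivity), one_mul, inv_pow,
    ← zpow_natCast, ← zpow_neg, Padic.norm_int_le_pow_iff_dvd]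
  simp

noncomputable instance QlModZl.instDivisibleBy (l : ℕ) [Fact l.Prime] :
    DivisibleBy (QlModZl l) ℤ :=
  divisibleByOfSMulRightSurj _ _ fun {n} hn x ↦ by
    obtain ⟨x, rfl⟩ := QuotientAddGroup.mk_surjective x
    refine ⟨QuotientAddGroup.mk (x / n), ?_⟩
    have : (n : ℚ_[l]) ≠ 0 := by exact_mod_cast hn
    beta_reduce
    rw [← QuotientAddGroup.mk_zsmul, zsmul_eq_mul, mul_div_cancel₀ _ this]

noncomputable instance IsAlgClosed.instDivisibleByUnits (k : Type*) [Field k] [IsAlgClosed k] :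
    DivisibleBy (Additive kˣ) ℤ :=
  haveI : DivisibleBy (Additive kˣ) ℕ := divisibleByOfSMulRightSurj _ _ fun {n} hn x ↦ by
    obtain ⟨z, hz⟩ := IsAlgClosed.exists_pow_nat_eq (x.toMul : k) (Nat.pos_of_ne_zero hn)
    have hz0 : z ≠ 0 := by
      rintro rfl
      rw [zero_pow hn] at hz
      exact x.toMul.ne_zero hz.symm
    refine ⟨Additive.ofMul (Units.mk0 z hz0), ?_⟩
    apply Additive.toMul.injective
    ext
    simpa using hz
  AddGroup.divisibleByIntOfDivisibleByNat _

/-- For an algebraically closed field `k` of characteristic `≠ l` the group `ℚ_l / ℤ_l` is a direct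
summand of `kˣ`. -/
theorem QlModZl.exists_retract_units (l : ℕ) [Fact l.Prime] (k : Type*) [Field k] [IsAlgClosed k]
    (hl : ringChar k ≠ l) :
    ∃ (i : QlModZl l →+ Additive kˣ) (r : Additive kˣ →+ QlModZl l), ∀ x, r (i x) = x := by
  have hp : l.Prime := Fact.out
  have : NeZero (l : k) := ⟨fun h0 ↦ hl <| by
    rcases (Nat.dvd_prime hp).1 (ringChar.dvd h0) with h | h
    · exact absurd h (CharP.ringChar_ne_one)
    · exact h⟩
  obtain ⟨ζ, hζ⟩ := HasEnoughRootsOfUnity.exists_primitiveRoot k l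
  have hζ' : IsPrimitiveRoot (hζ.isUnit hp.ne_zero).unit l := by
    rwa [← IsPrimitiveRoot.coe_units_iff]
  set z := (hζ.isUnit hp.ne_zero).unit
  let e : QlModZl l := QuotientAddGroup.mk ((l : ℚ_[l]) ^ 1)⁻¹
  have he : (l : ℤ) • e = 0 := (QlModZl.zsmul_eq_zero_iff 1 _).2 (by simp)
  let f : ZMod l →+ QlModZl l := ZMod.lift l ⟨zmultiplesHom _ e, by simpa using he⟩
  let g : ZMod l →+ Additive kˣ := ZMod.lift l ⟨zmultiplesHom _ (Additive.ofMul z), by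
    apply Additive.toMul.injective
    simpa using hζ'.pow_eq_one⟩
  have hf : ∀ a : ℤ, f a = a • e := fun a ↦ by simp [f]
  have hg : ∀ a : ℤ, g a = a • Additive.ofMul z := fun a ↦ by simp [g]
  have hfinj : Function.Injective f := by
    rw [injective_iff_map_eq_zero]
    intro a ha
    obtain ⟨a, rfl⟩ := ZMod.intCast_surjective a
    rw [hf, QlModZl.zsmul_eq_zero_iff, pow_one] at ha
    rwa [ZMod.intCast_zmod_eq_zero_iff_dvd]
  -- Divisible groups are injective: the map from `ℤ/l` onto the `l`-th roots of unity extends from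
  -- the `l`-torsion to all of `ℚ_l/ℤ_l`.
  obtain ⟨i, hi⟩ := (Module.Baer.of_divisible (A := Additive kˣ)).extension_property_addMonoidHom
    f hfinj g
  have hi' : ∀ a, i (f a) = g a := fun a ↦ DFunLike.congr_fun hi a
  have hker : ∀ x : QlModZl l, l • x = 0 → i x = 0 → x = 0 := fun x hx hix ↦ by
    obtain ⟨a, rfl⟩ := QlModZl.exists_eq_nsmul_of_pow_smul_eq_zero (m := 1) (x := x) (by simpa)
    have h1 : f (a : ℤ) = a • e := by rw [hf, natCast_zsmul]
    change i (a • e) = 0 at hix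
    change a • e = 0
    rw [← h1, hi', hg] at hix
    have : z ^ (a : ℤ) = 1 := congrArg Additive.toMul hix
    rw [hζ'.zpow_eq_one_iff_dvd] at this
    rw [← natCast_zsmul]
    exact (QlModZl.zsmul_eq_zero_iff 1 _).2 (by simpa using this)
  -- In an `l`-primary group every nontrivial subgroup meets the `l`-torsion, so injectivity there
  -- suffices.
  have hiinj : Function.Injective i := by
    rw [injective_iff_map_eq_zero]
    intro x hx
    obtain ⟨m, hm⟩ := QlModZl.exists_pow_smul_eq_zero x
    induction m with
    | zero => simpa using hm
    | succ m ih =>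
      refine ih (hker _ ?_ ?_)
      · rwa [← mul_smul, mul_comm, ← pow_succ]
      · rw [map_nsmul, hx, smul_zero]
  obtain ⟨r, hr⟩ := (Module.Baer.of_divisible (A := QlModZl l)).extension_property_addMonoidHom
    i hiinj (AddMonoidHom.id _)
  exact ⟨i, r, fun x ↦ DFunLike.congr_fun hr x⟩

/-! ### Descent from `Gal(Ω/E)` to the finite quotient `G` -/

/-- Restriction of scalars `Gal(Ω/F) → Gal(Ω/E)` is continuous at `1`. -/
theorem AlgEquiv.preimage_restrictScalars_mem_nhds_one {E F Ω : Type*} [Field E] [Field F]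
    [Field Ω] [Algebra E F] [Algebra F Ω] [Algebra E Ω] [IsScalarTower E F Ω]
    (U : Set (Ω ≃ₐ[E] Ω)) (hU : U ∈ nhds 1) :
    (AlgEquiv.restrictScalars E : (Ω ≃ₐ[F] Ω) → (Ω ≃ₐ[E] Ω)) ⁻¹' U ∈ nhds 1 := by
  obtain ⟨K, hK, hKU⟩ := (krullTopology_mem_nhds_one_iff E Ω U).1 hU
  obtain ⟨S, rfl⟩ := IntermediateField.essFiniteType_iff.1 (inferInstance : Algebra.EssFiniteType E K)
  refine (krullTopology_mem_nhds_one_iff F Ω _).2 ⟨IntermediateField.adjoin F S, ?_, fun σ hσ ↦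
    hKU ?_⟩
  · refine IntermediateField.finiteDimensional_adjoin fun x hx ↦ ?_
    have : IsIntegral E (⟨x, IntermediateField.subset_adjoin E _ hx⟩ :
      IntermediateField.adjoin E (S : Set Ω)) := Algebra.IsIntegral.isIntegral _
    exact (this.map (IntermediateField.val _)).tower_top
  · have h1 : ∀ x ∈ (S : Set Ω), σ x = x := fun x hx ↦
      hσ ⟨x, IntermediateField.subset_adjoin F _ hx⟩
    change _ ∈ IntermediateField.fixingSubgroup _
    rw [← Subgroup.zpowers_le, ← IntermediateField.le_iff_le, IntermediateField.adjoin_le_iff]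
    rintro x hx ⟨τ, n, rfl⟩
    have h2 : AlgEquiv.restrictScalars E σ ∈ MulAction.stabilizer (Ω ≃ₐ[E] Ω) x := h1 x hx
    exact zpow_mem h2 n

section Inflation

variable {k E F Ω G : Type*} [Field k] [Field E] [Field F] [Field Ω] [Algebra k F] [Algebra k E]
  [Algebra k Ω] [Algebra E F] [Algebra F Ω] [Algebra E Ω] [IsScalarTower k F Ω]
  [IsScalarTower k E Ω] [IsScalarTower E F Ω] [Group G]

/-- The descent step from `Gal(Ω/E)` to `G = Gal(F/E)`: a `2`-cocycle of `G` with values in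
constants which becomes a coboundary of constants on `Gal(Ω/E)` is, up to a `p`-power, a coboundary
of nonzero elements of `F`. -/
theorem exists_coboundary_of_inflation [Finite G] [Normal E Ω] (φ : (Ω ≃ₐ[E] Ω) →* G)
    (hφ : Function.Surjective φ) (β : G →* (F ≃ₐ[k] F)) (hβ : Function.Injective β)
    (hφβ : ∀ σ x, σ (algebraMap F Ω x) = algebraMap F Ω (β (φ σ) x))
    (q : ℕ) [ExpChar F q] (c : G → G → kˣ) (b : (Ω ≃ₐ[E] Ω) → kˣ) (hb1 : b 1 = 1)
    (hb : b ⁻¹' {1} ∈ nhds 1) (hbc : ∀ σ τ, c (φ σ) (φ τ) * b (σ * τ) = b σ * b τ) :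
    ∃ (m : ℕ) (a : G → F), (∀ g, a g ≠ 0) ∧
      ∀ g h, algebraMap k F (c g h ^ q ^ m : kˣ) * a (g * h) = a g * β g (a h) := by
  cases nonempty_fintype G
  have : Normal F Ω := Normal.tower_top_of_normal E F Ω
  have hc1 : ∀ h, c 1 h = 1 := fun h ↦ by
    obtain ⟨τ, rfl⟩ := hφ h
    simpa [hb1] using hbc 1 τ
  have hc2 : ∀ g, c g 1 = 1 := fun g ↦ by
    obtain ⟨τ, rfl⟩ := hφ g
    simpa [hb1] using hbc τ 1
  have hk : ∀ (σ : Ω ≃ₐ[E] Ω) (x : k), σ (algebraMap k Ω x) = algebraMap k Ω x := fun σ x ↦ by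
    rw [IsScalarTower.algebraMap_apply k E Ω, σ.commutes]
  have hker : ∀ ν : Ω ≃ₐ[F] Ω, φ (ν.restrictScalars E) = 1 := fun ν ↦ by
    refine hβ (AlgEquiv.ext fun x ↦ (algebraMap F Ω).injective ?_)
    rw [← hφβ]
    simp
  have hlift : ∀ ν : Ω ≃ₐ[E] Ω, φ ν = 1 → ∃ ν' : Ω ≃ₐ[F] Ω, ν'.restrictScalars E = ν :=
    fun ν hν ↦ ⟨{ ν with commutes' := fun x ↦ by simpa [hν] using hφβ ν x }, rfl⟩
  -- On `Gal(Ω/F)`, which `φ` kills, the normalized cocycle `c` is trivial, so `b` is a character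
  -- there.
  let χ : (Ω ≃ₐ[F] Ω) →* Fˣ :=
    { toFun := fun ν ↦ Units.map (algebraMap k F).toMonoidHom (b (ν.restrictScalars E))
      map_one' := by
        change Units.map _ (b 1) = 1
        rw [hb1, map_one]
      map_mul' := fun ν μ ↦ by
        rw [← map_mul, ← hbc, hker, hc1, one_mul]
        rfl }
  obtain ⟨y, hy0, hy⟩ := exists_eigenvector_of_character F Ω χ <| by
    refine Subgroup.isOpen_of_mem_nhds _ (g := 1) (Filter.mem_of_superset
      (AlgEquiv.preimage_restrictScalars_mem_nhds_one (F := F) _ hb) fun ν hν ↦ ?_)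
    have : b (ν.restrictScalars E) = 1 := hν
    change Units.map _ (b (ν.restrictScalars E)) = 1
    rw [this, map_one]
  have hy' : ∀ ν : Ω ≃ₐ[E] Ω, φ ν = 1 → ν y = algebraMap k Ω (b ν) * y := fun ν hν ↦ by
    obtain ⟨ν', rfl⟩ := hlift ν hν
    rw [IsScalarTower.algebraMap_apply k F Ω]
    exact hy ν'
  have hσy : ∀ σ : Ω ≃ₐ[E] Ω, σ y ≠ 0 := fun σ ↦ by simpa using hy0
  have hbk : ∀ σ, algebraMap k Ω (b σ) ≠ 0 := fun σ ↦ by simp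
  -- Changing `b` by the coboundary of the eigenvector `y` still cobounds `c`, but now gives `1` on
  -- the kernel of `φ`; so `A` depends only on `φ σ` and its values are fixed by `Gal(Ω/F)`.
  let A : (Ω ≃ₐ[E] Ω) → Ω := fun σ ↦ algebraMap k Ω (b σ) * y / σ y
  have hA0 : ∀ σ, A σ ≠ 0 := fun σ ↦ div_ne_zero (mul_ne_zero (hbk σ) hy0) (hσy σ)
  have hAc : ∀ σ τ, algebraMap k Ω (c (φ σ) (φ τ)) * A (σ * τ) = A σ * σ (A τ) := fun σ τ ↦ by
    have h1 := congrArg (fun z : kˣ ↦ algebraMap k Ω z) (hbc σ τ)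
    have h2 := hσy σ
    have h3 := hσy (σ * τ)
    simp only [A, map_mul, map_div₀, hk, Units.val_mul, AlgEquiv.mul_apply] at h1 h2 h3 ⊢
    field_simp
    linear_combination h1
  have hAker : ∀ ν, φ ν = 1 → A ν = 1 := fun ν hν ↦ by
    simp only [A]
    rw [hy' ν hν, div_self (mul_ne_zero (hbk ν) hy0)]
  have hAφ : ∀ σ τ, φ σ = φ τ → A σ = A τ := fun σ τ h ↦ by
    have h1 : φ (τ⁻¹ * σ) = 1 := by rw [map_mul, map_inv, h, inv_mul_cancel]
    have h2 := hAc τ (τ⁻¹ * σ)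
    rwa [h1, hc2, hAker _ h1, mul_inv_cancel_left, Units.val_one, map_one, one_mul, map_one,
      mul_one] at h2
  have hAfix : ∀ σ (ν : Ω ≃ₐ[F] Ω), ν (A σ) = A σ := fun σ ν ↦ by
    have h1 := hAc (ν.restrictScalars E) σ
    rw [hker, hc1, hAker _ (hker ν), Units.val_one, map_one, one_mul, one_mul] at h1
    refine h1.symm.trans (hAφ _ _ ?_)
    rw [map_mul, hker, one_mul]
  choose s hs using hφ
  -- Fixed elements are only purely inseparable over `F`; as `G` is finite, one power `q ^ M` brings
  -- all values into `F`.
  choose m hm using fun σ ↦ exists_pow_mem_of_forall_fixed F Ω q (A σ) (hAfix σ)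
  let M := Finset.univ.sup fun g ↦ m (s g)
  have hM : ∀ g, ∃ x, algebraMap F Ω x = A (s g) ^ q ^ M := fun g ↦ by
    obtain ⟨x, hx⟩ := hm (s g)
    obtain ⟨d, hd⟩ := Nat.exists_eq_add_of_le (Finset.le_sup (f := fun g ↦ m (s g))
      (Finset.mem_univ g))
    refine ⟨x ^ q ^ d, ?_⟩
    rw [map_pow, hx, ← pow_mul, ← pow_add]
    exact congrArg (fun z ↦ A (s g) ^ q ^ z) hd.symm
  choose a ha using hM
  refine ⟨M, a, fun g h0 ↦ ?_, fun g h ↦ (algebraMap F Ω).injective ?_⟩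
  · refine pow_ne_zero (q ^ M) (hA0 (s g)) ?_
    rw [← ha, h0, map_zero]
  · have h1 := hφβ (s g) (a h)
    rw [hs] at h1
    rw [map_mul, map_mul, ← h1, ha, ha, ha, ← IsScalarTower.algebraMap_apply k F Ω,
      hAφ (s (g * h)) (s g * s h) (by rw [map_mul, hs, hs, hs]), map_pow (s g), ← mul_pow, ← hAc,
      hs, hs, mul_pow, Units.val_pow_eq_pow_val, map_pow (algebraMap k Ω)]

end Inflation

section RestrictionHom

variable {k E F Ω G : Type*} [Field k] [Field E] [Field F] [Field Ω] [Algebra k F] [Algebra k E]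
  [Algebra E F] [Algebra E Ω] [IsScalarTower k E F] [Group G] [Normal E Ω]

/-- Variant of `exists_coboundary_of_inflation` for an embedding `ι` of `F` into `Ω`. -/
theorem exists_coboundary_of_inflation_of_algHom [Finite G] (ι : F →ₐ[E] Ω) (φ : (Ω ≃ₐ[E] Ω) →* G)
    (hφ : Function.Surjective φ) (β : G →* (F ≃ₐ[k] F)) (hβ : Function.Injective β)
    (hφβ : ∀ σ x, σ (ι x) = ι (β (φ σ) x))
    (q : ℕ) [ExpChar F q] (c : G → G → kˣ) (b : (Ω ≃ₐ[E] Ω) → kˣ) (hb1 : b 1 = 1)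
    (hb : b ⁻¹' {1} ∈ nhds 1) (hbc : ∀ σ τ, c (φ σ) (φ τ) * b (σ * τ) = b σ * b τ) :
    ∃ (m : ℕ) (a : G → F), (∀ g, a g ≠ 0) ∧
      ∀ g h, algebraMap k F (c g h ^ q ^ m : kˣ) * a (g * h) = a g * β g (a h) := by
  let _ : Algebra F Ω := ι.toRingHom.toAlgebra
  have : IsScalarTower E F Ω := IsScalarTower.of_algebraMap_eq fun x ↦ (ι.commutes x).symm
  let _ : Algebra k Ω := ((algebraMap E Ω).comp (algebraMap k E)).toAlgebra
  have : IsScalarTower k E Ω := IsScalarTower.of_algebraMap_eq fun x ↦ rfl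
  have : IsScalarTower k F Ω := IsScalarTower.of_algebraMap_eq fun x ↦ by
    rw [IsScalarTower.algebraMap_apply k E Ω, IsScalarTower.algebraMap_apply k E F]
    exact (ι.commutes _).symm
  exact exists_coboundary_of_inflation φ hφ β hβ hφβ q c b hb1 hb hbc

/-- The restriction homomorphism `Gal(Ω/E) → Gal(F/E) = G` for an embedding `ι` of a finite Galois
extension `F` of `E` into `Ω`. -/
theorem exists_restrictionHom [IsGalois E F] [FiniteDimensional E F] (ι : F →ₐ[E] Ω)
    (e : G ≃* (F ≃ₐ[E] F)) [TopologicalSpace G] [DiscreteTopology G] :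
    ∃ φ : (Ω ≃ₐ[E] Ω) →* G, Continuous φ ∧ Function.Surjective φ ∧
      ∀ σ x, σ (ι x) = ι (e (φ σ) x) := by
  let _ : Algebra F Ω := ι.toRingHom.toAlgebra
  have : IsScalarTower E F Ω := IsScalarTower.of_algebraMap_eq fun x ↦ (ι.commutes x).symm
  let φ : (Ω ≃ₐ[E] Ω) →* G := e.symm.toMonoidHom.comp (AlgEquiv.restrictNormalHom F)
  have hnat : ∀ σ x, σ (ι x) = ι (e (φ σ) x) := fun σ x ↦ by
    change _ = ι (e (e.symm _) x)
    rw [e.apply_symm_apply]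
    exact (AlgEquiv.restrictNormal_commutes σ F x).symm
  refine ⟨φ, continuous_of_continuousAt_one φ ?_,
    e.symm.surjective.comp (AlgEquiv.restrictNormalHom_surjective Ω), hnat⟩
  rw [ContinuousAt, map_one, nhds_discrete G, Filter.tendsto_pure]
  have : FiniteDimensional E ι.fieldRange :=
    (AlgEquiv.ofInjectiveField ι).toLinearEquiv.finiteDimensional
  -- The kernel contains the fixing subgroup of `ι(F)`, which is finite over `E`.
  refine (krullTopology_mem_nhds_one_iff E Ω _).2 ⟨ι.fieldRange, this, fun σ hσ ↦ ?_⟩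
  refine e.injective (AlgEquiv.ext fun x ↦ ι.injective ?_)
  rw [map_one]
  exact (hnat σ x).symm.trans (hσ ⟨ι x, x, rfl⟩)

end RestrictionHom

theorem AlgebraicClosure.normal (E : Type*) [Field E] : Normal E (AlgebraicClosure E) :=
  inferInstance

/-! ### The extension `k(V)/k(V)^G` -/

section InvariantField

variable {k : Type u} [Field k] {G : Type v} [Group G] {V : Type w} [AddCommGroup V] [Module k V]

instance PolyFun.instUniqueFactorizationMonoid : UniqueFactorizationMonoid (PolyFun k V) :=
  (SymmetricAlgebra.equivMvPolynomial
    (Module.Basis.ofVectorSpace k (Module.Dual k V))).symm.toMulEquiv.uniqueFactorizationMonoid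
    inferInstance

theorem PolyFun.exists_algebraMap_eq_of_isUnit {r : PolyFun k V} (hr : IsUnit r) :
    ∃ x : kˣ, algebraMap k (PolyFun k V) x = r := by
  let e := SymmetricAlgebra.equivMvPolynomial (Module.Basis.ofVectorSpace k (Module.Dual k V))
  obtain ⟨x, hx, h⟩ := MvPolynomial.isUnit_iff_eq_C_of_isReduced.1 (hr.map e)
  refine ⟨hx.unit, e.injective ?_⟩
  rw [h, e.commutes]
  rfl

theorem polyFunAction_apply_ι (ρ : Representation k G V) (g : G) (x : Module.Dual k V) :
    polyFunAction ρ g (SymmetricAlgebra.ι k _ x) = SymmetricAlgebra.ι k _ (ρ.dual g x) :=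
  SymmetricAlgebra.lift_ι_apply _ _

theorem ratFunAction_algebraMap (ρ : Representation k G V) (g : G) (x : PolyFun k V) :
    ratFunAction ρ g (algebraMap _ (RatFun k V) x) = algebraMap _ _ (polyFunAction ρ g x) :=
  IsFractionRing.fieldEquivOfAlgEquiv_algebraMap k (RatFun k V) (RatFun k V) _ x

/-- An element acting trivially on `k(V)` fixes all linear forms, and these separate the vectors of
`V`. -/
theorem ratFunAction_injective (ρ : Representation k G V) (hρ : Function.Injective ρ) :
    Function.Injective (ratFunAction ρ) := by
  rw [injective_iff_map_eq_one]
  intro g hg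
  refine inv_eq_one.1 (hρ (LinearMap.ext fun v ↦ ?_))
  rw [map_one, ← sub_eq_zero, ← Module.forall_dual_apply_eq_zero_iff k]
  intro f
  have h1 : SymmetricAlgebra.ι k _ (ρ.dual g f) = SymmetricAlgebra.ι k _ f := by
    rw [← polyFunAction_apply_ι]
    refine IsFractionRing.injective (PolyFun k V) (RatFun k V) ?_
    rw [← ratFunAction_algebraMap, hg, AlgEquiv.one_apply]
  -- Evaluation at `v` is an algebra homomorphism `k[V] → k`; it recovers `f v` from the image of
  -- `f` in `k[V]`.
  have h2 := congrArg (SymmetricAlgebra.lift (Module.Dual.eval k V v)) h1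
  rw [SymmetricAlgebra.lift_ι_apply, SymmetricAlgebra.lift_ι_apply] at h2
  rw [map_sub, sub_eq_zero]
  exact h2

/-- This is the input for Artin's theorem: with `G` finite, `k(V)` is finite Galois over its
invariants. -/
instance ratFunAction_range_isGaloisGroup (ρ : Representation k G V) :
    IsGaloisGroup (ratFunAction ρ).range (invariantField ρ) (RatFun k V) where
  faithful := inferInstance
  commutes := ⟨fun g a x ↦ by
    rw [Algebra.smul_def, smul_mul', Algebra.smul_def]
    exact congrArg (· * g • x) (a.2 g)⟩
  isInvariant := ⟨fun x hx ↦ ⟨⟨x, hx⟩, rfl⟩⟩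

variable [Finite G]

instance ratFunAction_range_finite (ρ : Representation k G V) : Finite (ratFunAction ρ).range :=
  Finite.of_surjective _ (ratFunAction ρ).rangeRestrict_surjective

instance invariantField_isGalois (ρ : Representation k G V) :
    IsGalois (invariantField ρ) (RatFun k V) :=
  IsGaloisGroup.isGalois (ratFunAction ρ).range _ _

instance invariantField_finiteDimensional (ρ : Representation k G V) :
    FiniteDimensional (invariantField ρ) (RatFun k V) :=
  IsGaloisGroup.finiteDimensional (ratFunAction ρ).range _ _

instance invariantField_normal_algebraicClosure (ρ : Representation k G V) :
    Normal (invariantField ρ) (AlgebraicClosure (invariantField ρ)) :=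
  AlgebraicClosure.normal _

/-- The natural homomorphism `G_E → Gal(k(V)/k(V)^G) = G`. -/
theorem exists_isNaturalHom (ρ : Representation k G V) (hρ : Function.Injective ρ)
    (ι : RatFun k V →ₐ[invariantField ρ] AlgebraicClosure (invariantField ρ))
    [TopologicalSpace G] [DiscreteTopology G] :
    ∃ φ : Field.absoluteGaloisGroup (invariantField ρ) →ₜ* G,
      IsNaturalHom ρ ι φ ∧ Function.Surjective φ := by
  obtain ⟨φ, hc, hs, h⟩ := exists_restrictionHom ι
    ((MonoidHom.ofInjective (ratFunAction_injective ρ hρ)).trans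
      (IsGaloisGroup.mulEquivAlgEquiv (ratFunAction ρ).range (invariantField ρ) (RatFun k V)))
  exact ⟨⟨φ, hc⟩, h, hs⟩

/-- The map `H²(G, kˣ) → H²(G_E, kˣ)`, for `E = k(V)^G`, is injective (on the level of cochains). -/
theorem exists_units_coboundary_of_inflation [IsAlgClosed k] (ρ : Representation k G V)
    (hρ : Function.Injective ρ)
    (ι : RatFun k V →ₐ[invariantField ρ] AlgebraicClosure (invariantField ρ))
    [TopologicalSpace G] (φ : Field.absoluteGaloisGroup (invariantField ρ) →ₜ* G)
    (hφ : IsNaturalHom ρ ι φ) (hφs : Function.Surjective φ) (c : G → G → kˣ)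
    (b : Field.absoluteGaloisGroup (invariantField ρ) → kˣ) (hb : IsLocallyConstant b)
    (hbc : ∀ σ τ, c (φ σ) (φ τ) * b (σ * τ) = b σ * b τ) :
    ∃ u : G → kˣ, ∀ g h, c g h * u (g * h) = u g * u h := by
  let q := ringExpChar k
  have : ExpChar (RatFun k V) q :=
    expChar_of_injective_algebraMap (algebraMap k (RatFun k V)).injective q
  -- Dividing `b` and `c` by the constant `b 1` normalizes `b` to be `1` at the identity.
  obtain ⟨m, a, ha0, ha⟩ := exists_coboundary_of_inflation_of_algHom ι
    (φ : Field.absoluteGaloisGroup (invariantField ρ) →* G) hφs (ratFunAction ρ)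
    (ratFunAction_injective ρ hρ) hφ q (fun g h ↦ c g h / b 1) (fun σ ↦ b σ / b 1)
    (div_self' _) ((hb.isOpen_fiber (b 1)).mem_nhds rfl |> Filter.mem_of_superset <| fun σ hσ ↦ by
      change b σ / b 1 = 1
      rw [show b σ = b 1 from hσ, div_self']) fun σ τ ↦ by
        refine (div_mul_div_comm _ _ _ _).trans (.trans ?_ (div_mul_div_comm _ _ _ _).symm)
        exact congrArg (· / _) (hbc σ τ)
  obtain ⟨u, hu⟩ := exists_const_coboundary_of_coboundary
    (fun r ↦ PolyFun.exists_algebraMap_eq_of_isUnit (r := r))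
    (fun g ↦ (polyFunAction ρ g).toRingEquiv) (ratFunAction ρ)
    (ratFunAction_algebraMap ρ) _ a ha0 ha
  have hq : q ^ m ≠ 0 := pow_ne_zero _ (expChar_pos k q).ne'
  have hroot : ∀ g, ∃ v : kˣ, v ^ q ^ m = u g := fun g ↦ by
    obtain ⟨z, hz⟩ := IsAlgClosed.exists_pow_nat_eq (u g : k) (Nat.pos_of_ne_zero hq)
    have hz0 : z ≠ 0 := by
      rintro rfl
      rw [zero_pow hq] at hz
      exact (u g).ne_zero hz.symm
    exact ⟨Units.mk0 z hz0, Units.ext hz⟩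
  choose v hv using hroot
  refine ⟨fun g ↦ v g * b 1, fun g h ↦ ?_⟩
  -- The `q ^ m`-th powers of both sides agree, and Frobenius is injective on `k`.
  have key : c g h / b 1 * v (g * h) = v g * v h := by
    refine Units.ext (iterateFrobenius_inj k q m ?_)
    rw [iterateFrobenius_def, iterateFrobenius_def, ← Units.val_pow_eq_pow_val,
      ← Units.val_pow_eq_pow_val, mul_pow, mul_pow, hv, hv, hv, hu]
  rw [div_mul_eq_mul_div, div_eq_iff_eq_mul] at key
  rw [← mul_assoc, key]
  simp only [mul_comm, mul_left_comm, mul_assoc]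

/-- The map `H²(G, ℚ_l/ℤ_l) → H²(G_E, ℚ_l/ℤ_l)`, for `E = k(V)^G`, is injective (on the level of
cochains). -/
theorem exists_coboundary_of_inflation_invariantField [IsAlgClosed k] (l : ℕ) [Fact l.Prime]
    (hl : ringChar k ≠ l) (ρ : Representation k G V) (hρ : Function.Injective ρ)
    (ι : RatFun k V →ₐ[invariantField ρ] AlgebraicClosure (invariantField ρ))
    [TopologicalSpace G] (φ : Field.absoluteGaloisGroup (invariantField ρ) →ₜ* G)
    (hφ : IsNaturalHom ρ ι φ) (hφs : Function.Surjective φ) (c : G → G → QlModZl l)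
    (b : Field.absoluteGaloisGroup (invariantField ρ) → QlModZl l) (hb : IsLocallyConstant b)
    (hbc : ∀ σ τ, c (φ σ) (φ τ) + b (σ * τ) = b σ + b τ) :
    ∃ u : G → QlModZl l, ∀ g h, c g h + u (g * h) = u g + u h := by
  obtain ⟨i, r, hir⟩ := QlModZl.exists_retract_units l k hl
  obtain ⟨u, hu⟩ := exists_units_coboundary_of_inflation ρ hρ ι φ hφ hφs
    (fun g h ↦ (i (c g h)).toMul) (fun σ ↦ (i (b σ)).toMul)
    (hb.comp fun x ↦ (i x).toMul) fun σ τ ↦ by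
      rw [← toMul_add, ← map_add, hbc, map_add, toMul_add]
  refine ⟨fun g ↦ r (Additive.ofMul (u g)), fun g h ↦ ?_⟩
  rw [← map_add, ← ofMul_mul, ← hu, ofMul_mul, map_add, ofMul_toMul, hir]

end InvariantField

/-! ### Injectivity on homology of complexes of topological modules -/

section HomologyInjective

open CategoryTheory CategoryTheory.Limits

variable {R : Type u} [Ring R] [TopologicalSpace R]

/-- Any cokernel is isomorphic, compatibly with the projections, to the explicit quotient by the
range, where both claims are evident. -/
theorem TopModuleCat.surjective_and_exact_of_isColimit {M N Q : TopModuleCat.{v} R} (φ : M ⟶ N)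
    (π : N ⟶ Q) (w : φ ≫ π = 0) (h : IsColimit (CokernelCofork.ofπ π w)) :
    Function.Surjective π.hom ∧ ∀ x, π.hom x = 0 → ∃ y, φ.hom y = x := by
  let e := h.coconePointUniqueUpToIso (TopModuleCat.isColimitCoker φ)
  have he : π ≫ e.hom = TopModuleCat.cokerπ φ :=
    h.comp_coconePointUniqueUpToIso_hom (TopModuleCat.isColimitCoker φ) WalkingParallelPair.one
  have he' : ∀ x, e.hom.hom (π.hom x) = (TopModuleCat.cokerπ φ).hom x := fun x ↦
    congrArg (fun t : N ⟶ TopModuleCat.coker φ ↦ t.hom x) he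
  constructor
  · intro q
    obtain ⟨x, hx⟩ := TopModuleCat.cokerπ_surjective φ (e.hom.hom q)
    refine ⟨x, ?_⟩
    rw [← he'] at hx
    have := congrArg e.inv.hom hx
    have hid : ∀ z, e.inv.hom (e.hom.hom z) = z := fun z ↦
      congrArg (fun t : Q ⟶ Q ↦ t.hom z) e.hom_inv_id
    rwa [hid, hid] at this
  · intro x hx
    have h1 : (TopModuleCat.cokerπ φ).hom x = 0 := by rw [← he', hx, map_zero]
    rw [TopModuleCat.hom_cokerπ] at h1
    exact (Submodule.Quotient.mk_eq_zero _).1 h1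

theorem TopModuleCat.injective_of_isLimit {K M N : TopModuleCat.{v} R} (φ : M ⟶ N)
    (ι : K ⟶ M) (w : ι ≫ φ = 0) (h : IsLimit (KernelFork.ofι ι w)) :
    Function.Injective ι.hom := by
  let e := h.conePointUniqueUpToIso (TopModuleCat.isLimitKer φ)
  have he : e.hom ≫ TopModuleCat.kerι φ = ι :=
    h.conePointUniqueUpToIso_hom_comp (TopModuleCat.isLimitKer φ) WalkingParallelPair.zero
  intro x y hxy
  have he' : ∀ x, (TopModuleCat.kerι φ).hom (e.hom.hom x) = ι.hom x := fun x ↦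
    congrArg (fun t ↦ t.hom x) he
  rw [← he', ← he'] at hxy
  have := congrArg e.inv.hom (Subtype.val_injective hxy)
  have hid : ∀ z, e.inv.hom (e.hom.hom z) = z := fun z ↦
    congrArg (fun t : K ⟶ K ↦ t.hom z) e.hom_inv_id
  rwa [hid, hid] at this

/-- A criterion for the injectivity on cohomology of a morphism of complexes of topological
modules. -/
theorem TopModuleCat.homologyMap_injective {C D : CochainComplex (TopModuleCat.{v} R) ℕ}
    (f : C ⟶ D) (n : ℕ)
    (h : ∀ x : C.X (n + 1), (C.d (n + 1) (n + 2)).hom x = 0 → ∀ y : D.X n,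
      (D.d n (n + 1)).hom y = (f.f (n + 1)).hom x → ∃ z, (C.d n (n + 1)).hom z = x) :
    Function.Injective (HomologicalComplex.homologyMap f (n + 1)).hom := by
  have hC := TopModuleCat.surjective_and_exact_of_isColimit _ _ _
    (C.homologyIsCokernel n (n + 1) (by simp))
  have hD := TopModuleCat.surjective_and_exact_of_isColimit _ _ _
    (D.homologyIsCokernel n (n + 1) (by simp))
  have hCi := TopModuleCat.injective_of_isLimit _ _ _ (C.cyclesIsKernel (n + 1) (n + 2) (by simp))
  rw [injective_iff_map_eq_zero]
  intro t ht
  obtain ⟨x, rfl⟩ := hC.1 t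
  have h1 : (D.homologyπ (n + 1)).hom ((HomologicalComplex.cyclesMap f (n + 1)).hom x) = 0 := by
    rw [← ht]
    exact congrArg (fun t ↦ t.hom x) (HomologicalComplex.homologyπ_naturality f (n + 1)).symm
  obtain ⟨y, hy⟩ := hD.2 _ h1
  obtain ⟨z, hz⟩ := h ((C.iCycles (n + 1)).hom x)
    (congrArg (fun t ↦ t.hom x) (C.iCycles_d (n + 1) (n + 2))) y (by
      have h2 := congrArg (fun t ↦ t.hom x) (HomologicalComplex.cyclesMap_i f (n + 1))
      have h3 := congrArg (fun t ↦ t.hom y) (D.toCycles_i n (n + 1))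
      refine h3.symm.trans (.trans ?_ h2)
      exact congrArg (D.iCycles (n + 1)).hom hy)
  have h4 : (C.toCycles n (n + 1)).hom z = x := hCi <| by
    rw [← hz]
    exact congrArg (fun t ↦ t.hom z) (C.toCycles_i n (n + 1))
  rw [← h4]
  exact congrArg (fun t ↦ t.hom z) (C.toCycles_comp_homologyπ n (n + 1))

end HomologyInjective

/-! ### From homogeneous to inhomogeneous cochains -/

section InflationH2

variable (l : ℕ) [Fact l.Prime] {Γ Δ : Type u}
    [Group Γ] [TopologicalSpace Γ] [IsTopologicalGroup Γ]
    [Group Δ] [TopologicalSpace Δ] [IsTopologicalGroup Δ]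

open TopRep

theorem trivialQlModZl_d_two_apply (y : C(Γ, C(Γ, ULift.{u} (QlModZl l)))) (a b c : Γ) :
    ((d (trivialQlModZl l Γ) 2).hom y : C(Γ, C(Γ, C(Γ, ULift.{u} (QlModZl l))))) a b c =
      y b c - (y a c - y a b) := rfl

theorem trivialQlModZl_mem_invariants_two_iff (y : C(Γ, C(Γ, ULift.{u} (QlModZl l)))) :
    y ∈ (resolutionX (trivialQlModZl l Γ) 2).ρ.invariants ↔
      ∀ g a b, y (g⁻¹ * a) (g⁻¹ * b) = y a b := by
  rw [ContRepresentation.mem_invariants]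
  refine forall_congr' fun g ↦ ⟨fun h a b ↦ ?_, fun h ↦ ?_⟩
  · exact congrArg (fun z : C(Γ, C(Γ, ULift.{u} (QlModZl l))) ↦ z a b) h
  · exact ContinuousMap.ext fun a ↦ ContinuousMap.ext fun b ↦ h a b

theorem trivialQlModZl_mem_invariants_three_iff (y : C(Γ, C(Γ, C(Γ, ULift.{u} (QlModZl l))))) :
    y ∈ (resolutionX (trivialQlModZl l Γ) 3).ρ.invariants ↔
      ∀ g a b c, y (g⁻¹ * a) (g⁻¹ * b) (g⁻¹ * c) = y a b c := by
  rw [ContRepresentation.mem_invariants]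
  refine forall_congr' fun g ↦ ⟨fun h a b c ↦ ?_, fun h ↦ ?_⟩
  · exact congrArg (fun z : C(Γ, C(Γ, C(Γ, ULift.{u} (QlModZl l)))) ↦ z a b c) h
  · exact ContinuousMap.ext fun a ↦ ContinuousMap.ext fun b ↦ ContinuousMap.ext fun c ↦ h a b c

/-- A homogeneous cochain `x` corresponds to `c g h = x 1 g (g * h)`, and `y` to `b σ = y 1 σ`.
Conversely `u` gives the invariant cochain `u (g⁻¹ * h)`, continuous because `Γ` is discrete. -/
theorem inflationH2_injective [DiscreteTopology Γ] (φ : Δ →ₜ* Γ)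
    (h : ∀ (c : Γ → Γ → QlModZl l) (b : Δ → QlModZl l), IsLocallyConstant b →
      (∀ σ τ, c (φ σ) (φ τ) + b (σ * τ) = b σ + b τ) →
      ∃ u : Γ → QlModZl l, ∀ g h, c g h + u (g * h) = u g + u h) :
    Function.Injective (inflationH2 l φ).hom := by
  refine TopModuleCat.homologyMap_injective _ 1 fun x _ y hxy ↦ ?_
  obtain ⟨x, hx⟩ := x
  obtain ⟨y, hy⟩ := y
  change C(Γ, C(Γ, C(Γ, ULift.{u} (QlModZl l)))) at x
  change C(Δ, C(Δ, ULift.{u} (QlModZl l))) at y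
  have hx' := (trivialQlModZl_mem_invariants_three_iff l x).1 hx
  have hy' := (trivialQlModZl_mem_invariants_two_iff l y).1 hy
  have key : ∀ a b c, y b c - (y a c - y a b) = x (φ a) (φ b) (φ c) := fun a b c ↦ by
    have h1 : (d (trivialQlModZl l Δ) 2).hom y = _ :=
      (homogeneousCochains.d_apply (trivialQlModZl l Δ) 1 ⟨y, hy⟩).symm.trans
        (congrArg Subtype.val hxy)
    exact congrArg (fun z : C(Δ, C(Δ, C(Δ, ULift.{u} (QlModZl l)))) ↦ z a b c) h1
  obtain ⟨u, hu⟩ := h (fun g h ↦ (x 1 g (g * h)).down) (fun σ ↦ (y 1 σ).down)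
    ((IsLocallyConstant.iff_continuous _).2 (by fun_prop)) fun σ τ ↦ by
      have h1 := key 1 σ (σ * τ)
      have h2 := hy' σ σ (σ * τ)
      rw [inv_mul_cancel, inv_mul_cancel_left] at h2
      rw [← h2, map_one φ, map_mul φ] at h1
      rw [← h1]
      simp only [ULift.sub_down]
      abel
  let w : C(Γ, C(Γ, ULift.{u} (QlModZl l))) :=
    ⟨fun g ↦ ⟨fun h ↦ ⟨u (g⁻¹ * h)⟩, continuous_of_discreteTopology⟩,
      continuous_of_discreteTopology⟩
  have hw : w ∈ (resolutionX (trivialQlModZl l Γ) 2).ρ.invariants := by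
    rw [trivialQlModZl_mem_invariants_two_iff]
    intro g a b
    simp [w, mul_assoc]
  refine ⟨⟨w, hw⟩, Subtype.ext ?_⟩
  refine (homogeneousCochains.d_apply (trivialQlModZl l Γ) 1 ⟨w, hw⟩).trans ?_
  refine ContinuousMap.ext fun a ↦ ContinuousMap.ext fun b ↦ ContinuousMap.ext fun c ↦ ?_
  refine (trivialQlModZl_d_two_apply l w a b c).trans ?_
  change _ = x a b c
  have h1 := hu (a⁻¹ * b) (b⁻¹ * c)
  have h2 := hx' a a b c
  have h3 : a⁻¹ * b * (b⁻¹ * c) = a⁻¹ * c := by group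
  rw [inv_mul_cancel] at h2
  rw [h3, h2] at h1
  apply ULift.ext
  change u (b⁻¹ * c) - (u (a⁻¹ * c) - u (a⁻¹ * b)) = _
  rw [eq_sub_of_add_eq h1]
  abel

end InflationH2

/-! ### Lifting problems for central extensions -/

section Lifting

/-- If the inflation `H²(G, A) → H²(Δ, A)` is injective (on the level of cochains) for a
homomorphism `φ : Δ → G` that lifts to a central extension `X` of `G`, then every homomorphism from
the kernel of `X → G` to `A` extends to `X`. -/
theorem exists_extension_of_lift {A X G Δ : Type*} [AddCommGroup A] [Group X] [Group G] [Group Δ]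
    [TopologicalSpace Δ] (φ : Δ →* G)
    (h : ∀ (c : G → G → A) (b : Δ → A), IsLocallyConstant b →
      (∀ σ τ, c (φ σ) (φ τ) + b (σ * τ) = b σ + b τ) →
      ∃ u : G → A, ∀ g h, c g h + u (g * h) = u g + u h)
    (π : X →* G) (hπ : Function.Surjective π) (hcent : π.ker ≤ Subgroup.center X)
    (ψ : Δ →* X) (hψ : IsLocallyConstant ψ) (hψφ : ∀ σ, π (ψ σ) = φ σ)
    (j : π.ker →* Multiplicative A) :
    ∃ θ : X →* Multiplicative A, ∀ x : π.ker, θ x = j x := by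
  choose s hs using hπ
  -- Relative to the section `s`, `κ x` is the kernel component of `x`, and `d` is the factor set of
  -- the extension.
  let κ : X → π.ker := fun x ↦ ⟨x * (s (π x))⁻¹, by simp [MonoidHom.mem_ker, hs]⟩
  let d : G → G → π.ker := fun g h ↦ ⟨s g * s h * (s (g * h))⁻¹, by simp [MonoidHom.mem_ker, hs]⟩
  have hκ : ∀ x y, κ (x * y) = κ x * κ y * d (π x) (π y) := fun x y ↦ Subtype.ext <| by
    have h1 := Subgroup.mem_center_iff.1 (hcent (κ y).2) (s (π x))
    change x * y * (s (π (x * y)))⁻¹ = x * (s (π x))⁻¹ * (κ y : X) *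
      (s (π x) * s (π y) * (s (π x * π y))⁻¹)
    rw [map_mul]
    calc x * y * (s (π x * π y))⁻¹
        = x * (s (π x))⁻¹ * (s (π x) * (κ y : X)) * s (π y) * (s (π x * π y))⁻¹ := by
          simp only [κ]; group
      _ = _ := by rw [h1]; group
  -- By `hκ` along the lift `ψ`, the inflated class of `j ∘ d` is the coboundary of `-j ∘ κ ∘ ψ`.
  obtain ⟨u, hu⟩ := h (fun g h ↦ (j (d g h)).toAdd) (fun σ ↦ -(j (κ (ψ σ))).toAdd)
    (hψ.comp fun x ↦ -(j (κ x)).toAdd) fun σ τ ↦ by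
      rw [map_mul ψ, hκ, map_mul j, map_mul j, toAdd_mul, toAdd_mul, hψφ, hψφ]
      abel
  let θ : X →* Multiplicative A := MonoidHom.mk' (fun x ↦ j (κ x) * .ofAdd (u (π x))) fun x y ↦ by
    have h1 := congrArg Multiplicative.ofAdd (hu (π x) (π y))
    rw [ofAdd_add, ofAdd_add, ofAdd_toAdd] at h1
    rw [hκ, map_mul, map_mul, map_mul, mul_assoc, h1]
    exact mul_mul_mul_comm _ _ _ _
  refine ⟨θ, fun x ↦ ?_⟩
  -- The section need not send `1` to `1`; the resulting constant factor is `θ 1 = 1`.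
  have h1 : κ (x : X) = x * κ 1 := Subtype.ext <| by
    change (x : X) * (s (π x))⁻¹ = x * (1 * (s (π 1))⁻¹)
    rw [map_one, one_mul, MonoidHom.mem_ker.1 x.2]
  have h2 : θ x = j x * θ 1 := by
    change j (κ x) * .ofAdd (u (π x)) = j x * (j (κ 1) * .ofAdd (u (π 1)))
    rw [h1, map_mul, mul_assoc, map_one π, MonoidHom.mem_ker.1 x.2]
  rw [h2, map_one, mul_one]

/-- The class in `ℚ_l / ℤ_l` of `l⁻ᵐ` spans a copy of `ℤ/lᵐ`. -/
theorem QlModZl.exists_zmodHom (l : ℕ) [Fact l.Prime] (m : ℕ) :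
    ∃ e : ZMod (l ^ m) →+ QlModZl l, Function.Injective e ∧
      ∀ a : ℤ, e a = a • QuotientAddGroup.mk ((l : ℚ_[l]) ^ m)⁻¹ := by
  let e : ZMod (l ^ m) →+ QlModZl l := ZMod.lift (l ^ m)
    ⟨zmultiplesHom _ (QuotientAddGroup.mk ((l : ℚ_[l]) ^ m)⁻¹), by
      rw [zmultiplesHom_apply]
      exact (QlModZl.zsmul_eq_zero_iff m _).2 dvd_rfl⟩
  have he : ∀ a : ℤ, e a = a • QuotientAddGroup.mk ((l : ℚ_[l]) ^ m)⁻¹ := fun a ↦ by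
    simp only [e, ZMod.lift_coe, zmultiplesHom_apply]
  refine ⟨e, (injective_iff_map_eq_zero _).2 fun a ha ↦ ?_, he⟩
  obtain ⟨a, rfl⟩ := ZMod.intCast_surjective a
  rw [he, QlModZl.zsmul_eq_zero_iff] at ha
  rwa [ZMod.intCast_zmod_eq_zero_iff_dvd]

/-- A central extension by `ℤ/lⁿ` for which the embedding of `ℤ/lⁿ` into `ℚ_l / ℤ_l` extends to the
middle group is induced from an extension of cyclic groups. -/
theorem isInducedFromCyclic_of_extension {l : ℕ} [Fact l.Prime] {n : ℕ} {X G : Type*} [Group X]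
    [Group G] [Finite X] (S : GroupExtension (Multiplicative (ZMod (l ^ n))) X G)
    (θ : X →* Multiplicative (QlModZl l))
    (hθ : ∀ a : ℤ, θ (S.inl (.ofAdd (a : ZMod (l ^ n)))) =
      .ofAdd (a • QuotientAddGroup.mk ((l : ℚ_[l]) ^ n)⁻¹)) :
    IsInducedFromCyclic S := by
  cases nonempty_fintype X
  choose M hM using fun x ↦ QlModZl.exists_pow_smul_eq_zero (θ x).toAdd
  -- Since `X` is finite, `lᵐ` kills `θ(X)`. Using `ℤ/lⁿ⁺ᵐ` as the target makes the restriction to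
  -- `ℤ/lⁿ` exactly multiplication by `lᵐ`.
  let m := Finset.univ.sup M
  obtain ⟨e, he, hea⟩ := QlModZl.exists_zmodHom l (n + m)
  have hm : ∀ x, ∃ y, e y = (θ x).toAdd := fun x ↦ by
    obtain ⟨a, ha⟩ := QlModZl.exists_eq_nsmul_of_pow_smul_eq_zero (m := n + m) (x := (θ x).toAdd) (by
      obtain ⟨t, ht⟩ := Nat.exists_eq_add_of_le (Finset.le_sup (f := M) (Finset.mem_univ x))
      have : n + m = n + t + M x := by
        change m = M x + t at ht
        omega
      rw [this, pow_add, mul_smul, hM, smul_zero])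
    exact ⟨(a : ℤ), by rw [hea, ha, natCast_zsmul]⟩
  choose f hf using hm
  let θ' : X →* Multiplicative (ZMod (l ^ (n + m))) := MonoidHom.mk' (fun x ↦ .ofAdd (f x))
    fun x y ↦ Multiplicative.toAdd.injective <| he <| by
      simp only [toAdd_mul, toAdd_ofAdd, map_add, hf, map_mul]
  have hl : (l : ℚ_[l]) ≠ 0 := by exact_mod_cast (Fact.out : l.Prime).ne_zero
  have hinl : ∀ a, θ' (S.inl a) = (cyclicExtension l n m).inl a := fun a ↦ by
    obtain ⟨a, rfl⟩ : ∃ b : ℤ, Multiplicative.ofAdd (b : ZMod (l ^ n)) = a :=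
      ZMod.intCast_surjective (n := l ^ n) a.toAdd
    refine Multiplicative.toAdd.injective (he ?_)
    change e (f _) = e (cyclicInl l n m (a : ZMod (l ^ n)))
    rw [hf, hθ, cyclicInl_intCast, hea, toAdd_ofAdd, mul_smul]
    congr 1
    rw [← QuotientAddGroup.mk_zsmul, zsmul_eq_mul]
    congr 1
    push_cast
    rw [pow_add]
    field_simp
  have hker : S.rightHom.ker ≤ ((cyclicExtension l n m).rightHom.comp θ').ker := by
    rw [← S.range_inl_eq_ker_rightHom]
    rintro _ ⟨a, rfl⟩
    rw [MonoidHom.mem_ker, MonoidHom.comp_apply, hinl, GroupExtension.rightHom_inl]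
  let χ : G →* Multiplicative (ZMod (l ^ m)) :=
    MonoidHom.liftOfSurjective _ S.rightHom_surjective ⟨_, hker⟩
  have hχ : ∀ x, χ (S.rightHom x) = (cyclicExtension l n m).rightHom (θ' x) := fun x ↦
    MonoidHom.liftOfRightInverse_comp_apply _ _
      (Function.rightInverse_surjInv S.rightHom_surjective) ⟨_, hker⟩ x
  -- A homomorphism of extensions that is the identity on kernel and quotient is an equivalence.
  refine ⟨m, χ, ⟨GroupExtension.Equiv.ofMonoidHom
    ((θ'.prod S.rightHom).codRestrict _ fun x ↦ (hχ x).symm) ?_ ?_⟩⟩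
  · refine MonoidHom.ext fun a ↦ ?_
    refine Subtype.ext (Prod.ext (hinl a) ?_)
    exact S.rightHom_inl a
  · rfl

end Lifting

/-! ### Galois groups mapping to a given finite group -/

/-- The left regular representation is faithful. -/
theorem leftRegular_injective (k G : Type*) [Field k] [Group G] :
    Function.Injective (Representation.leftRegular k G) := fun g h hgh ↦ by
  have := DFunLike.congr_fun hgh (MonoidAlgebra.single 1 1)
  simp only [Representation.ofMulAction_single, smul_eq_mul, mul_one] at this
  exact MonoidAlgebra.single_left_injective one_ne_zero this

theorem AlgebraicClosure.nonempty_algHom (E F : Type*) [Field E] [Field F] [Algebra E F]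
    [FiniteDimensional E F] : Nonempty (F →ₐ[E] AlgebraicClosure E) :=
  ⟨IsAlgClosed.lift⟩

theorem invariantField_nonempty_algHom {k : Type u} [Field k] {G : Type v} [Group G] [Finite G]
    {V : Type w} [AddCommGroup V] [Module k V] (ρ : Representation k G V) :
    Nonempty (RatFun k V →ₐ[invariantField ρ] AlgebraicClosure (invariantField ρ)) :=
  AlgebraicClosure.nonempty_algHom _ _

/-- For a finite group `G` there is a homomorphism `G_E → G` such that the induced map
`H²(G, ℚ_l/ℤ_l) → H²(G_E, ℚ_l/ℤ_l)` is injective (on the level of cochains). -/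
theorem exists_absoluteGaloisGroup_hom (k : Type u) [Field k] [IsAlgClosed k] (l : ℕ)
    [Fact l.Prime] (hl : ringChar k ≠ l) (G : Type v) [Group G] [Finite G] [TopologicalSpace G]
    [DiscreteTopology G] :
    ∃ (E : Type (max u v)) (_ : Field E) (_ : Algebra k E) (φ : Field.absoluteGaloisGroup E →ₜ* G),
      ∀ (c : G → G → QlModZl l) (b : Field.absoluteGaloisGroup E → QlModZl l),
        IsLocallyConstant b → (∀ σ τ, c (φ σ) (φ τ) + b (σ * τ) = b σ + b τ) →
        ∃ u : G → QlModZl l, ∀ g h, c g h + u (g * h) = u g + u h := by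
  have hρ := leftRegular_injective k G
  obtain ⟨ι⟩ := invariantField_nonempty_algHom (Representation.leftRegular k G)
  obtain ⟨φ, hφ, hφs⟩ := exists_isNaturalHom _ hρ ι
  exact ⟨_, _, inferInstance, φ, exists_coboundary_of_inflation_invariantField l hl _ hρ ι φ hφ hφs⟩

/-! ### Dihedral groups -/

theorem dihedralProj_surjective (n : ℕ) : Function.Surjective (dihedralProj n) := by
  have h := ZMod.castHom_surjective (Dvd.intro_left 2 rfl : n ∣ 2 * n)
  rintro (i | i)
  · obtain ⟨j, rfl⟩ := h i
    exact ⟨.r j, rfl⟩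
  · obtain ⟨j, rfl⟩ := h i
    exact ⟨.sr j, rfl⟩

theorem mem_ker_dihedralProj {n : ℕ} {x : DihedralGroup (2 * n)} (hx : x ∈ (dihedralProj n).ker) :
    x = 1 ∨ x = .r (n : ZMod (2 * n)) := by
  rcases x with i | i
  · obtain ⟨a, rfl⟩ := ZMod.intCast_surjective i
    have h1 : DihedralGroup.r ((ZMod.castHom (Dvd.intro_left 2 rfl) (ZMod n)) (a : ZMod (2 * n))) =
      DihedralGroup.r 0 := hx
    rw [DihedralGroup.r.injEq, map_intCast, ZMod.intCast_zmod_eq_zero_iff_dvd] at h1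
    obtain ⟨b, rfl⟩ := h1
    have h2 : (2 * n : ZMod (2 * n)) = 0 := by exact_mod_cast ZMod.natCast_self (2 * n)
    rcases Int.even_or_odd' b with ⟨t, rfl | rfl⟩
    · left
      rw [← DihedralGroup.r_zero]
      congr 1
      push_cast
      linear_combination (t : ZMod (2 * n)) * h2
    · right
      congr 1
      push_cast
      linear_combination (t : ZMod (2 * n)) * h2
  · have h1 : DihedralGroup.sr _ = DihedralGroup.r (0 : ZMod n) := hx
    exact nomatch h1

/-- The extension `D_{2n} → D_n` is central, and the nontrivial homomorphism from its kernel to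
`ℚ_2/ℤ_2` does not extend to `D_{2n}`, because the kernel consists of commutators. -/
theorem dihedral_no_extension (n : ℕ) (hn : 0 < n) (hn2 : Even n) :
    (dihedralProj n).ker ≤ Subgroup.center (DihedralGroup (2 * n)) ∧
      ∃ j : (dihedralProj n).ker →* Multiplicative (QlModZl 2),
        ¬ ∃ θ : DihedralGroup (2 * n) →* Multiplicative (QlModZl 2),
          ∀ x : (dihedralProj n).ker, θ x = j x := by
  have h2 : (n + n : ZMod (2 * n)) = 0 := by
    rw [← two_mul]
    exact_mod_cast ZMod.natCast_self (2 * n)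
  have hne : (n : ZMod (2 * n)) ≠ 0 := fun h ↦ by
    have := Nat.le_of_dvd hn ((ZMod.natCast_eq_zero_iff _ _).1 h)
    omega
  have hsq : (DihedralGroup.r (n : ZMod (2 * n))) * .r n = 1 := by
    rw [DihedralGroup.r_mul_r, h2, DihedralGroup.r_zero]
  have hne1 : DihedralGroup.r (n : ZMod (2 * n)) ≠ 1 := fun h ↦ hne (by
    rwa [← DihedralGroup.r_zero, DihedralGroup.r.injEq] at h)
  refine ⟨fun x hx ↦ ?_, ?_⟩
  · rcases mem_ker_dihedralProj hx with rfl | rfl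
    · exact one_mem _
    · rw [Subgroup.mem_center_iff]
      rintro (i | i)
      · rw [DihedralGroup.r_mul_r, DihedralGroup.r_mul_r, add_comm]
      · rw [DihedralGroup.sr_mul_r, DihedralGroup.r_mul_sr]
        congr 1
        -- The rotation by `n` is central because `n = -n` modulo `2 * n`.
        linear_combination h2
  · obtain ⟨e, he, -⟩ := QlModZl.exists_zmodHom 2 1
    have h1 : e 1 + e 1 = 0 := by
      rw [← map_add]
      exact (congrArg e (by decide)).trans (map_zero e)
    have he1 : e 1 ≠ 0 := fun h ↦ absurd (he (h.trans (map_zero e).symm)) (by decide)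
    classical
    let j : (dihedralProj n).ker →* Multiplicative (QlModZl 2) := MonoidHom.mk'
      (fun x ↦ if (x : DihedralGroup (2 * n)) = 1 then 1 else .ofAdd (e 1)) fun x y ↦ by
        have h1' : Multiplicative.ofAdd (e 1) * Multiplicative.ofAdd (e 1) = 1 := h1
        rcases mem_ker_dihedralProj x.2 with hx | hx <;>
          rcases mem_ker_dihedralProj y.2 with hy | hy <;>
          simp only [Subgroup.coe_mul, hx, hy, hsq, one_mul, mul_one, if_pos, if_neg hne1, h1']
    refine ⟨j, fun ⟨θ, hθ⟩ ↦ ?_⟩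
    have hmem : DihedralGroup.r (n : ZMod (2 * n)) ∈ (dihedralProj n).ker := by
      change DihedralGroup.r ((ZMod.castHom (Dvd.intro_left 2 rfl) (ZMod n)) (n : ZMod (2 * n))) =
        DihedralGroup.r 0
      rw [map_natCast, ZMod.natCast_self]
    have h3 : θ (.r n) = .ofAdd (e 1) := (hθ ⟨_, hmem⟩).trans (if_neg hne1)
    obtain ⟨m, rfl⟩ := hn2
    -- Evenness enters here: for `n = 2m` the kernel generator is the commutator of `r m` and a
    -- reflection, so it dies in every abelian group.
    have h4 : DihedralGroup.r ((m + m : ℕ) : ZMod (2 * (m + m))) =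
        .r m * .sr 0 * (.r m)⁻¹ * (.sr 0)⁻¹ := by
      simp
    rw [h4, map_mul, map_mul, map_mul, map_inv, map_inv, mul_inv_cancel_comm, mul_inv_cancel] at h3
    exact he1 h3.symm

/-! ### The main theorem -/

theorem mainTheorem4 (k : Type u) [Field k] [IsAlgClosed k] :
    (∀ (l : ℕ) [Fact l.Prime], ringChar k ≠ l →
      ∀ (G : Type u) [Group G] [Finite G] [TopologicalSpace G] [DiscreteTopology G],
        -- a field `E` over `k` and a homomorphism `G_E → G` that is injective on `H²`
        (∃ (E : Type u) (_ : Field E) (_ : Algebra k E) (φ : Field.absoluteGaloisGroup E →ₜ* G),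
          Function.Injective (inflationH2 l φ).hom) ∧
        -- one can take `E = k(V)^G` with the natural homomorphism `G_E → G`
        (∀ (V : Type u) [AddCommGroup V] [Module k V] [FiniteDimensional k V]
            (ρ : Representation k G V), Function.Injective ρ →
          Nonempty (RatFun k V →ₐ[invariantField ρ] AlgebraicClosure (invariantField ρ)) ∧
          ∀ ι : RatFun k V →ₐ[invariantField ρ] AlgebraicClosure (invariantField ρ),
            ∃ φ : Field.absoluteGaloisGroup (invariantField ρ) →ₜ* G,
              IsNaturalHom ρ ι φ ∧ Function.Surjective φ ∧
                Function.Injective (inflationH2 l φ).hom) ∧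
        -- central extensions by `ℤ/lⁿ` that are not induced from extensions of cyclic groups
        (∀ (n : ℕ) (G' : Type v) [Group G'] [TopologicalSpace G'] [DiscreteTopology G']
            (S : GroupExtension (Multiplicative (ZMod (l ^ n))) G' G),
          S.inl.range ≤ Subgroup.center G' → ¬ IsInducedFromCyclic S →
          ∃ (E : Type u) (_ : Field E) (_ : Algebra k E) (φ : Field.absoluteGaloisGroup E →ₜ* G),
            ¬ ∃ ψ : Field.absoluteGaloisGroup E →ₜ* G', ∀ σ, S.rightHom (ψ σ) = φ σ)) ∧
    -- dihedral groups
    (ringChar k ≠ 2 → ∀ n : ℕ, 0 < n → Even n →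
      ∃ (K : Type u) (_ : Field K) (_ : Algebra k K)
        (φ : Field.absoluteGaloisGroup K →ₜ* DihedralGroup n),
        ¬ ∃ ψ : Field.absoluteGaloisGroup K →ₜ* DihedralGroup (2 * n),
          ∀ σ, dihedralProj n (ψ σ) = φ σ) := by
  refine ⟨fun l _ hl G _ _ _ _ ↦ ⟨?_, fun V _ _ _ ρ hρ ↦ ?_, fun n G' _ _ _ S hS hind ↦ ?_⟩,
    fun h2 n hn hn2 ↦ ?_⟩
  · obtain ⟨E, _, _, φ, hφ⟩ := exists_absoluteGaloisGroup_hom k l hl G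
    exact ⟨E, _, inferInstance, φ, inflationH2_injective l φ hφ⟩
  · refine ⟨invariantField_nonempty_algHom ρ, fun ι ↦ ?_⟩
    obtain ⟨φ, hφ, hφs⟩ := exists_isNaturalHom ρ hρ ι
    exact ⟨φ, hφ, hφs, inflationH2_injective l φ
      (exists_coboundary_of_inflation_invariantField l hl ρ hρ ι φ hφ hφs)⟩
  · obtain ⟨E, _, _, φ, hφ⟩ := exists_absoluteGaloisGroup_hom k l hl G
    refine ⟨E, _, inferInstance, φ, fun ⟨ψ, hψ⟩ ↦ hind ?_⟩
    have : NeZero (l ^ n) := ⟨pow_ne_zero _ (Fact.out : l.Prime).ne_zero⟩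
    have : Finite S.inl.range := Finite.of_surjective _ S.inl.rangeRestrict_surjective
    have : Finite S.rightHom.ker := S.range_inl_eq_ker_rightHom ▸ this
    let s : G → G' := Function.surjInv S.rightHom_surjective
    have hs : ∀ g, S.rightHom (s g) = g := Function.surjInv_eq S.rightHom_surjective
    -- Every element of `G'` is a kernel element times a value of the section `s`.
    have : Finite G' := Finite.of_surjective (fun p : S.rightHom.ker × G ↦ (p.1 : G') * s p.2)
      fun x ↦ ⟨⟨⟨x * (s (S.rightHom x))⁻¹, by simp [MonoidHom.mem_ker, hs]⟩, S.rightHom x⟩,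
        by simp⟩
    obtain ⟨e, -, he⟩ := QlModZl.exists_zmodHom l n
    let i : S.rightHom.ker ≃* Multiplicative (ZMod (l ^ n)) :=
      ((MonoidHom.ofInjective S.inl_injective).trans
        (MulEquiv.subgroupCongr S.range_inl_eq_ker_rightHom)).symm
    -- A lift `ψ` would let the embedding of the kernel `ℤ/lⁿ` into `ℚ_l/ℤ_l` extend to `G'`.
    obtain ⟨θ, hθ⟩ := exists_extension_of_lift (φ : Field.absoluteGaloisGroup E →* G) hφ
      S.rightHom S.rightHom_surjective (S.range_inl_eq_ker_rightHom ▸ hS)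
      (ψ : Field.absoluteGaloisGroup E →* G') ((IsLocallyConstant.iff_continuous _).2 ψ.continuous)
      hψ (e.toMultiplicative.comp i.toMonoidHom)
    refine isInducedFromCyclic_of_extension S θ fun a ↦ ?_
    have h1 := hθ (i.symm (.ofAdd (a : ZMod (l ^ n))))
    have h2 : ((i.symm (.ofAdd (a : ZMod (l ^ n))) : S.rightHom.ker) : G') =
      S.inl (.ofAdd (a : ZMod (l ^ n))) := rfl
    rw [h2] at h1
    rw [h1, ← he]
    change Multiplicative.ofAdd (e (i (i.symm _)).toAdd) = _
    rw [i.apply_symm_apply, toAdd_ofAdd]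
  · have : NeZero n := ⟨hn.ne'⟩
    obtain ⟨E, _, _, φ, hφ⟩ := exists_absoluteGaloisGroup_hom k 2 h2 (DihedralGroup n)
    refine ⟨E, _, inferInstance, φ, fun ⟨ψ, hψ⟩ ↦ ?_⟩
    obtain ⟨hcent, j, hj⟩ := dihedral_no_extension n hn hn2
    exact hj (exists_extension_of_lift (φ : Field.absoluteGaloisGroup E →* DihedralGroup n) hφ
      (dihedralProj n) (dihedralProj_surjective n) hcent
      (ψ : Field.absoluteGaloisGroup E →* DihedralGroup (2 * n))
      ((IsLocallyConstant.iff_continuous _).2 ψ.continuous) hψ j)
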